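/- **Theorem 3 (Order conditions for LIRK-W methods of type 3).** An $s$-stage LIRK-W method is given by real coefficients $a_{ij}$ (with $a_{ij}=0$ for $j\ge i$), $\gamma_{ij}$ (with $\gamma_{ij}=0$ for $j>i$), $b_i$ and $g_i$, $1\le i,j\le s$. For an initial value problem $y'=F(y)$, $y(t_0)=y_0$, with $F:\mathbb{R}^N\to\mathbb{R}^N$ smooth, and an arbitrary smooth matrix function $\mathbf{L}:\mathbb{R}\to\mathbb{R}^{N\times N}$, one step of size $h>0$ of the type 3 method is $$Y_i = y_0 + h\sum_{j=1}^{i-1} a_{ij}\,F(Y_j) + h\,\mathbf{L}_i\sum_{j=1}^{i}\gamma_{ij}\,Y_j,\qquad \mathbf{L}_i=\mathbf{L}(t_0+h\gamma_{ii}),\quad 1\le i\le s,$$ $$y_1 = y_0 + h\sum_{j=1}^{s} b_j\,F(Y_j) + h\,\mathbf{L}\sum_{j=1}^{s} g_j\,Y_j,\qquad \mathbf{L}=\mathbf{L}(t_0);$$ for small $h$ these equations have exactly one solution. The method has order $p$ ($p\ge 0$ an integer) if $y_1-y(t_0+h)=O(h^{p+1})$ as $h\to 0^+$ for all $N$, $F$,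 $\mathbf{L}$, $t_0$, $y_0$ as above. *Trees.* LW-trees are the rooted trees with meagre, fat and square vertices in which a meagre vertex may have any finite number of children, a fat vertex has at most one child, and a square vertex has exactly one child, which is square or fat. Write $[\tau_1,\dots,\tau_m]_\bullet$ for the tree with meagre root and subtrees $\tau_1,\dots,\tau_m$ ($m\ge0$), and $[\tau]_{\theta_p}$, respectively $[\;]_{\theta_p}$, for the tree that consists of a chain of $p\ge 0$ square vertices ending in a fat vertex to which $\tau$, respectively nothing, is attached; $\theta_0$ is also written $\circ$. Every LW-tree is of one of these forms. $T$ is the set of Butcher trees (LW-trees with meagre vertices only), and $LW_3=LW_2$ is the set of LW-trees whose root is not square. $\rho(\tau)$ is the number of vertices of $\tau$, and $\gamma(\tau)$ is the product, over all vertices $v$ of $\tau$, of the number of vertices of the subtree rooted at $v$. *Coefficients.* For all LW-trees and stages $j$ define recursively $$\bar\Phi^3_j([\tau_1,\dots,\tau_m]_\bullet)=\sum_{k} a_{jk}\,\bar\Phi^3_k(\tau_1)\cdots\bar\Phi^3_k(\tau_m),\qquad \bar\Phi^3_j([\tau]_{\theta_p})=\sum_{k}\gamma_{jj}^p\gamma_{jk}\,\bar\Phi^3_k(\tau),\qquad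 \bar\Phi^3_j([\;]_{\theta_p})=\sum_k\gamma_{jj}^p\gamma_{jk},$$ with $\gamma_{jj}^0=1$, and for trees in $LW_3$ $$\Phi^3_j([\tau_1,\dots,\tau_m]_\bullet)=b_j\,\bar\Phi^3_j(\tau_1)\cdots\bar\Phi^3_j(\tau_m),\qquad \Phi^3_j([\tau]_\circ)=g_j\,\bar\Phi^3_j(\tau),\qquad \Phi^3_j([\;]_\circ)=g_j.$$ *Claim.* The type 3 LIRK-W method has order $p$ if and only if $$\sum_{j}\Phi^3_j(\tau)=\frac1{\gamma(\tau)}\quad\text{for all }\tau\in T\text{ with }\rho(\tau)\le p,\qquad\text{and}\qquad \sum_{j}\Phi^3_j(\tau)=0\quad\text{for all }\tau\in LW_3\setminus T\text{ with }\rho(\tau)\le p.$$ -/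

import Mathlib

open scoped ContDiff Topology

/-- Coefficients `(a, γ, b, g)` of an `s`-stage LIRK-W method: `a` is strictly lower triangular
(the nonlinear part is explicit) and `γ` is lower triangular (the linear part is diagonally
implicit). -/
structure LIRKW (s : ℕ) where
  a : Matrix (Fin s) (Fin s) ℝ
  γ : Matrix (Fin s) (Fin s) ℝ
  b : Fin s → ℝ
  g : Fin s → ℝ
  a_strictlyLower : ∀ i j, i ≤ j → a i j = 0
  γ_lower : ∀ i j, i < j → γ i j = 0

/-- LW-trees, by the three ways to build them:
* `meagre m τ` is `[τ₁, …, τₘ]_•` (for `m = 0` the single meagre vertex);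
* `fat p τ` is `[τ]_{θ_p}`: a chain of `p` square vertices that ends in a fat vertex, to which
  `τ` is attached; for `p = 0` it is `[τ]_∘`;
* `fatLeaf p` is `[ ]_{θ_p}`: the same chain with nothing attached to its fat vertex.

So fat vertices have at most one child, and square vertices have exactly one child, which is square
or fat. The children of a meagre vertex carry an order here; all quantities below are invariant
under permutations of it. -/
inductive LWTree : Type
  | meagre (m : ℕ) (τ : Fin m → LWTree) : LWTree
  | fatLeaf (p : ℕ) : LWTree
  | fat (p : ℕ) (τ : LWTree) : LWTree

namespace LWTree

/-- `ρ(τ)`: the number of vertices (meagre, fat and square). -/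
def order : LWTree → ℕ
  | meagre _ τ => 1 + ∑ i, (τ i).order
  | fatLeaf p => p + 1
  | fat p τ => p + 1 + τ.order

/-- `γ(τ)`: the product of the orders of all trees that appear when the roots are removed one
after another, i.e. the product over all vertices `v` of the order of the subtree rooted at `v`. -/
def density : LWTree → ℕ
  | meagre m τ => (meagre m τ).order * ∏ i, (τ i).density
  | fatLeaf p => ∏ q ∈ Finset.range (p + 1), (fatLeaf q).order
  | fat p τ => (∏ q ∈ Finset.range (p + 1), (fat q τ).order) * τ.density

/-- Butcher trees (the set `T`): all vertices are meagre. -/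
def IsButcher : LWTree → Prop
  | meagre _ τ => ∀ i, (τ i).IsButcher
  | fatLeaf _ => False
  | fat _ _ => False

/-- The set `LW₃` (which is `LW₂`): LW-trees whose root is not square. -/
def IsLW3 : LWTree → Prop
  | meagre _ _ => True
  | fatLeaf p => p = 0
  | fat p _ => p = 0

end LWTree

namespace LIRKW

variable {s : ℕ} (M : LIRKW s)

/-- `PhiBar τ j` is `Φ̄³_j(τ)`, the coefficient of a subtree `τ` in stage `j`, with the summations
over the inner stage indices carried out. -/
def PhiBar : LWTree → Fin s → ℝ
  | .meagre _ τ, j => ∑ k, M.a j k * ∏ i, PhiBar (τ i) k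
  | .fatLeaf p, j => ∑ k, M.γ j j ^ p * M.γ j k
  | .fat p τ, j => ∑ k, M.γ j j ^ p * M.γ j k * PhiBar τ k

/-- `Phi τ j` is `Φ³_j(τ)`. Trees with a square root are not in `LW₃` and get the value `0`. -/
def Phi : LWTree → Fin s → ℝ
  | .meagre _ τ, j => M.b j * ∏ i, M.PhiBar (τ i) j
  | .fatLeaf 0, j => M.g j
  | .fat 0 τ, j => M.g j * M.PhiBar τ j
  | .fatLeaf (_ + 1), _ => 0
  | .fat (_ + 1) _, _ => 0

/-- One step of size `h` of the type 3 method for `y' = F y`, from `y₀` at time `t₀` to `y₁`, with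
stages `Y i`. The matrix of stage `i` is `Lᵢ = L (t₀ + h γᵢᵢ)` and multiplies the whole sum
`∑ⱼ γᵢⱼ Yⱼ`; the update uses `L = L t₀`. Since `a` and `γ` are triangular, the stage sums run over
`j < i` and `j ≤ i`. For small `h` the equations have exactly one solution `(Y, y₁)`. -/
structure IsType3Step {N : ℕ} (F : (Fin N → ℝ) → Fin N → ℝ)
    (L : ℝ → Matrix (Fin N) (Fin N) ℝ) (t₀ : ℝ) (y₀ : Fin N → ℝ) (h : ℝ)
    (Y : Fin s → Fin N → ℝ) (y₁ : Fin N → ℝ) : Prop where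
  stage : ∀ i, Y i = y₀ + h • ∑ j, M.a i j • F (Y j)
    + h • (L (t₀ + h * M.γ i i)).mulVec (∑ j, M.γ i j • Y j)
  update : y₁ = y₀ + h • ∑ j, M.b j • F (Y j) + h • (L t₀).mulVec (∑ j, M.g j • Y j)

/-- The type 3 method has order (at least) `p`: for every smooth autonomous system `y' = F y` of any
dimension, every smooth time-dependent matrix `L`, every initial time `t₀` and every exact solution
`y` near `t₀`, the error after one step of size `h` is `O(h ^ (p + 1))` as `h → 0+`. -/
def HasOrderType3 (p : ℕ) : Prop :=
  ∀ (N : ℕ) (F : (Fin N → ℝ) → Fin N → ℝ) (L : ℝ → Matrix (Fin N) (Fin N) ℝ) (t₀ : ℝ)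
    (y : ℝ → Fin N → ℝ) (Y : ℝ → Fin s → Fin N → ℝ) (y₁ : ℝ → Fin N → ℝ),
    ContDiff ℝ ∞ F →
    (∀ i j, ContDiff ℝ ∞ fun t => L t i j) →
    (∀ᶠ t in 𝓝 t₀, HasDerivAt y (F (y t)) t) →
    (∀ᶠ h in 𝓝[>] (0 : ℝ), M.IsType3Step F L t₀ (y t₀) h (Y h) (y₁ h)) →
    (fun h => y₁ h - y (t₀ + h)) =O[𝓝[>] (0 : ℝ)] fun h => h ^ (p + 1)

end LIRKW

/-! The numerical and the exact solution have expansions `y₀ + ∑ h^ρ(τ) · coefficient(τ) · vector`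
over one finite family of trees with the same vectors. Only the coefficients differ: `∑ j, Phi τ j`
for the update, `exactCoeff τ` for the solution. The latter is `1/γ(τ)` on Butcher trees and `0`
elsewhere, since `L` does not enter the differential equation. If the coefficients agree up to order
`p`, the error is `O(h^(p+1))` (`error_isBigO`).

The expansions come from a fixed-point iteration: inserting stages known up to `O(h^k)` into the
right-hand side gains a factor `h` (`stage_expansion`), and integration does the same for the
solution (`exact_expansion`). Equal trees are never collected, so no symmetry factors appear.

Conversely, every tree `τ` has a test system that isolates it. Its coordinates are labelled by a
finite set of trees closed under subtrees, plus a constant, and the coordinate of `σ` in stage `j`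
is exactly `h^ρ(σ) · PhiBar σ j` (`coordValue_step`). For `τ` in LW₃ the error in the coordinate of
`τ` is `h^ρ(τ) · (∑ j, Phi τ j - exactCoeff τ)`; when `ρ(τ) ≤ p` this is `O(h^(p+1))` only if the
bracket vanishes. -/

open Filter Asymptotics

-- Taylor's formula and big-O estimates

universe u in
/-- Taylor's formula for smooth maps between normed spaces, with a big-O remainder. -/
theorem ContDiff.exists_multilinear_taylor {E : Type u} [NormedAddCommGroup E] [NormedSpace ℝ E]
    (x : E) (k : ℕ) : ∀ {G : Type u} [NormedAddCommGroup G] [NormedSpace ℝ G] {f : E → G},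
    ContDiff ℝ ∞ f → ∃ p : (m : ℕ) → ContinuousMultilinearMap ℝ (fun _ : Fin m => E) G,
      (fun δ : E => f (x + δ) - ∑ m : Fin k, p m fun _ => δ) =O[𝓝 0] fun δ => ‖δ‖ ^ k := by
  induction k with
  | zero =>
    intro G _ _ f hf
    refine ⟨fun _ => 0, ?_⟩
    have hc : ContinuousAt (fun δ : E => f (x + δ)) 0 :=
      (hf.continuous.comp (continuous_const.add continuous_id)).continuousAt
    simpa using hc.isBigO_one ℝ
  | succ k ih =>
    intro G _ _ f hf
    -- The induction passes to the derivative, with values in `E →L[ℝ] G`; hence `G` is quantified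
    -- inside the induction and shares the universe of `E`.
    obtain ⟨q, hq⟩ := ih (hf.fderiv_right (m := ∞) (by simp))
    -- Integrating the degree `m` term of the derivative along `t ↦ x + t • δ` produces the factor
    -- `1 / (m + 1)`.
    refine ⟨fun m => match m with
      | 0 => ContinuousMultilinearMap.constOfIsEmpty ℝ _ (f x)
      | m + 1 => ((m : ℝ) + 1)⁻¹ • (q m).uncurryRight, ?_⟩
    obtain ⟨C, hC⟩ := hq.bound
    obtain ⟨ε, hε, hb⟩ := Metric.eventually_nhds_iff_ball.1 hC
    refine IsBigO.of_bound C (Metric.eventually_nhds_iff_ball.2 ⟨ε, hε, fun δ hδ => ?_⟩)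
    have hCn : ∀ t ∈ Set.Ico (0 : ℝ) 1,
        ‖(fderiv ℝ f (x + t • δ) - ∑ m : Fin k, q m fun _ => t • δ) δ‖ ≤ C * ‖δ‖ ^ (k + 1) := by
      intro t ht
      have htδ : ‖t • δ‖ ≤ ‖δ‖ := by
        rw [norm_smul, Real.norm_of_nonneg ht.1]
        exact mul_le_of_le_one_left (norm_nonneg _) ht.2.le
      have h1 := hb (t • δ) (by
        rw [mem_ball_zero_iff] at hδ ⊢
        exact htδ.trans_lt hδ)
      refine (ContinuousLinearMap.le_opNorm _ _).trans ?_
      rw [norm_pow, norm_norm] at h1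
      by_cases hδ0 : δ = 0
      · simp [hδ0]
      have hC0 : 0 ≤ C := by
        have h2 := hb δ hδ
        rw [norm_pow, norm_norm] at h2
        exact nonneg_of_mul_nonneg_left ((norm_nonneg _).trans h2) (by positivity)
      calc _ ≤ C * ‖t • δ‖ ^ k * ‖δ‖ := by gcongr
        _ ≤ C * ‖δ‖ ^ k * ‖δ‖ := by gcongr
        _ = _ := by ring
    have hd : ∀ t ∈ Set.Icc (0 : ℝ) 1, HasDerivWithinAt
        (fun t : ℝ => f (x + t • δ) - ∑ m : Fin k, (t ^ (m + 1 : ℕ) * ((m : ℝ) + 1)⁻¹) •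
          q m (fun _ => δ) δ)
        ((fderiv ℝ f (x + t • δ) - ∑ m : Fin k, q m fun _ => t • δ) δ) (Set.Icc 0 1) t := by
      intro t _
      apply HasDerivAt.hasDerivWithinAt
      rw [sub_apply, sum_apply]
      refine HasDerivAt.sub ?_ (HasDerivAt.fun_sum fun m _ => ?_)
      · have h1 : HasDerivAt (fun t : ℝ => x + t • δ) δ t := by
          simpa using ((hasDerivAt_id t).smul_const δ).const_add x
        exact ((hf.differentiable (by simp)) (x + t • δ)).hasFDerivAt.comp_hasDerivAt t h1
      · have h1 : (q m fun _ => t • δ) δ = t ^ (m : ℕ) • q m (fun _ => δ) δ := by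
          rw [(q m).map_smul_univ (fun _ => t) (fun _ => δ)]
          simp
        rw [h1]
        have h2 := ((hasDerivAt_pow (m + 1 : ℕ) t).mul_const ((m : ℝ) + 1)⁻¹).smul_const
          (q m (fun _ => δ) δ)
        convert h2 using 2
        have : (m : ℝ) + 1 ≠ 0 := by positivity
        push_cast
        field_simp
    have := norm_image_sub_le_of_norm_deriv_le_segment_01' hd hCn
    rw [norm_pow, norm_norm]
    refine le_trans (le_of_eq ?_) this
    congr 1
    rw [Fin.sum_univ_succ]
    simp only [Fin.val_zero, Fin.val_succ, one_smul, zero_smul, one_pow, one_mul, add_zero,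
      zero_pow (Nat.succ_ne_zero _), zero_mul, Finset.sum_const_zero, sub_zero]
    rw [sub_add_eq_sub_sub, sub_right_comm]
    rfl

theorem isBigO_pow_of_le_nhds_zero {l : Filter ℝ} (hl : l ≤ 𝓝 0) {m n : ℕ} (h : m ≤ n) :
    (fun x : ℝ => x ^ n) =O[l] fun x => x ^ m := by
  refine IsBigO.mono (IsBigO.of_bound 1 ?_) hl
  filter_upwards [Metric.closedBall_mem_nhds (0 : ℝ) one_pos] with x hx
  rw [mem_closedBall_zero_iff] at hx
  rw [norm_pow, norm_pow, one_mul]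
  exact pow_le_pow_of_le_one (norm_nonneg _) hx h

/-- Mean value inequality on the ball of radius `‖h‖`, where the derivative is bounded by `C * ‖h‖ ^
k`. -/
theorem Asymptotics.IsBigO.integrate_pow {E : Type*} [NormedAddCommGroup E] [NormedSpace ℝ E] {f f' : ℝ → E}
    {k : ℕ} (hf : ∀ᶠ h in 𝓝 (0 : ℝ), HasDerivAt f (f' h) h) (hO : f' =O[𝓝 0] fun h => h ^ k)
    (h0 : f 0 = 0) : f =O[𝓝 0] fun h => h ^ (k + 1) := by
  obtain ⟨C, hC⟩ := hO.bound
  obtain ⟨ε, hε, hb⟩ := Metric.eventually_nhds_iff_ball.1 (hf.and hC)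
  refine IsBigO.of_bound C (Metric.eventually_nhds_iff_ball.2 ⟨ε, hε, fun h hh => ?_⟩)
  rw [mem_ball_zero_iff] at hh
  by_cases hne : h = 0
  · simp [hne, h0]
  have hC0 : 0 ≤ C := by
    have h2 := (hb h (by simpa using hh)).2
    exact nonneg_of_mul_nonneg_left ((norm_nonneg _).trans h2) (by
      rw [norm_pow]
      have := norm_pos_iff.2 hne
      positivity)
  have hsub : ∀ t ∈ Metric.closedBall (0 : ℝ) ‖h‖, t ∈ Metric.ball (0 : ℝ) ε := fun t ht => by
    rw [mem_closedBall_zero_iff] at ht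
    rw [mem_ball_zero_iff]
    exact ht.trans_lt hh
  have := (convex_closedBall (0 : ℝ) ‖h‖).norm_image_sub_le_of_norm_hasDerivWithin_le
    (f := f) (f' := f') (C := C * ‖h‖ ^ k) (x := 0) (y := h)
    (fun t ht => (hb t (hsub t ht)).1.hasDerivWithinAt)
    (fun t ht => by
      refine (hb t (hsub t ht)).2.trans ?_
      rw [mem_closedBall_zero_iff] at ht
      rw [norm_pow]
      gcongr) (by simp) (by simp)
  rw [h0, sub_zero, sub_zero] at this
  rw [norm_pow, pow_succ, ← mul_assoc]
  exact this

/-! ### Expansions in powers of the step size -/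

section Expansion

variable {E : Type*} [NormedAddCommGroup E] {l : Filter ℝ}

theorem isBigO_pow_mul_smul [NormedSpace ℝ E] (hl : l ≤ 𝓝 0) {k r : ℕ} (h : k ≤ r) (c : ℝ) (v : E) :
    (fun x : ℝ => (x ^ r * c) • v) =O[l] fun x => x ^ k := by
  have h1 : (fun x : ℝ => x ^ r * c) =O[l] fun x => x ^ k := by
    simpa only [mul_comm] using (isBigO_pow_of_le_nhds_zero hl h).const_mul_left c
  simpa using h1.smul (isBigO_const_const v (one_ne_zero (α := ℝ)) l)

theorem tendsto_zero_of_isBigO_pow (hl : l ≤ 𝓝 0) {k : ℕ} (hk : 1 ≤ k) {f : ℝ → E}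
    (hf : f =O[l] fun x => x ^ k) : Tendsto f l (𝓝 0) := by
  refine hf.trans_tendsto (Tendsto.mono_left ?_ hl)
  have : Tendsto (fun x : ℝ => x ^ k) (𝓝 0) (𝓝 (0 ^ k)) := (continuous_pow k).tendsto 0
  rwa [zero_pow (by omega)] at this

variable [NormedSpace ℝ E]

theorem ContinuousMultilinearMap.apply_sum_pow_smul {ι : Type*} [Fintype ι]
    {G : Type*} [NormedAddCommGroup G] [NormedSpace ℝ G] {m : ℕ}
    (p : ContinuousMultilinearMap ℝ (fun _ : Fin m => E) G) (r : ι → ℕ) (d : ι → ℝ) (u : ι → E)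
    (h : ℝ) :
    (p fun _ => ∑ x, (h ^ r x * d x) • u x) =
      ∑ f : Fin m → ι, (h ^ (∑ i, r (f i)) * ∏ i, d (f i)) • p (u ∘ f) := by
  classical
  rw [p.map_sum (g := fun _ x => (h ^ r x * d x) • u x)]
  refine Finset.sum_congr rfl fun f _ => ?_
  rw [p.map_smul_univ (fun i => h ^ r (f i) * d (f i)) (fun i => u (f i)), Finset.prod_mul_distrib,
    Finset.prod_pow_eq_pow_sum]
  rfl

/-- Composition of a smooth map with an expansion in powers of the step size. -/
theorem ContDiff.comp_expansion {G : Type*} [NormedAddCommGroup G] [NormedSpace ℝ G]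
    (hl : l ≤ 𝓝 0) {F : E → G} (hF : ContDiff ℝ ∞ F)
    {y₀ : E} {k : ℕ} (hk : 1 ≤ k)
    {p : (m : ℕ) → ContinuousMultilinearMap ℝ (fun _ : Fin m => E) G}
    (hp : (fun δ : E => F (y₀ + δ) - ∑ m : Fin k, p m fun _ => δ) =O[𝓝 0] fun δ => ‖δ‖ ^ k)
    {ι : Type*} [Fintype ι] {r : ι → ℕ} (hr : ∀ x, 1 ≤ r x) (d : ι → ℝ) (u : ι → E) {X : ℝ → E}
    (hX : (fun h => X h - (y₀ + ∑ x, (h ^ r x * d x) • u x)) =O[l] fun h => h ^ k) :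
    (fun h => F (X h) - ∑ m : Fin k, ∑ f : Fin m → ι,
      (h ^ (∑ i, r (f i)) * ∏ i, d (f i)) • p m (u ∘ f)) =O[l] fun h => h ^ k := by
  set P : ℝ → E := fun h => ∑ x, (h ^ r x * d x) • u x with hPdef
  have hP : P =O[l] fun h => h ^ 1 :=
    IsBigO.fun_sum fun x _ => isBigO_pow_mul_smul hl (hr x) _ _
  have hP0 : Tendsto P l (𝓝 0) := tendsto_zero_of_isBigO_pow hl le_rfl hP
  have hPy : Tendsto (fun h => y₀ + P h) l (𝓝 y₀) := by simpa using hP0.const_add y₀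
  have hX0 : Tendsto X l (𝓝 y₀) := by
    have h0 := (tendsto_zero_of_isBigO_pow hl hk hX).add hPy
    simp only [zero_add] at h0
    exact h0.congr fun h => sub_add_cancel _ _
  -- Strict differentiability makes `F` Lipschitz near `y₀`, so `X` may be replaced by its
  -- expansion.
  have h1 : (fun h => F (X h) - F (y₀ + P h)) =O[l] fun h => h ^ k :=
    ((hF.contDiffAt.hasStrictFDerivAt (by simp)).isBigO_sub.comp_tendsto
      (hX0.prodMk_nhds hPy)).trans hX
  have h2 : (fun h => F (y₀ + P h) - ∑ m : Fin k, p m fun _ => P h) =O[l] fun h => h ^ k := by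
    refine (hp.comp_tendsto hP0).trans ?_
    have := hP.norm_left.pow k
    simp only [pow_one] at this
    exact this
  refine (h1.add h2).congr_left fun h => ?_
  simp only [hPdef, ContinuousMultilinearMap.apply_sum_pow_smul]
  abel

/-- The indices of the terms that one application of the method creates from an expansion with
indices `ι`: forests below a meagre root, chains with nothing attached, chains above one tree. -/
abbrev NextIndex (k : ℕ) (ι : Type*) : Type _ := (Σ m : Fin k, Fin m → ι) ⊕ Fin k ⊕ (Fin k × ι)

/-- The vectors of the next expansion, for Taylor coefficients `p` of `F` and `Λ` of `L`. -/
def nextVector {k : ℕ} {ι : Type*} (y₀ : E)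
    (p : (m : ℕ) → ContinuousMultilinearMap ℝ (fun _ : Fin m => E) E) (Λ : ℕ → E →L[ℝ] E)
    (u : ι → E) : NextIndex k ι → E
  | .inl ⟨m, f⟩ => p m (u ∘ f)
  | .inr (.inl q) => Λ q y₀
  | .inr (.inr (q, x)) => Λ q (u x)

def nextOrder {k : ℕ} {ι : Type*} (r : ι → ℕ) : NextIndex k ι → ℕ
  | .inl ⟨_, f⟩ => 1 + ∑ i, r (f i)
  | .inr (.inl q) => q + 1
  | .inr (.inr (q, x)) => q + 1 + r x

/-- One formula for both uses: stage `i` takes the `i`-th rows of `a` and `γ` with `c = γᵢᵢ`, the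
update takes `b`, `g` and `c = 0`. -/
def nextCoeff {k : ℕ} {ι J : Type*} [Fintype J] (A Γ : J → ℝ) (c : ℝ) (d : J → ι → ℝ) :
    NextIndex k ι → ℝ
  | .inl ⟨_, f⟩ => ∑ j, A j * ∏ i, d j (f i)
  | .inr (.inl q) => ∑ j, c ^ (q : ℕ) * Γ j
  | .inr (.inr (q, x)) => ∑ j, c ^ (q : ℕ) * Γ j * d j x

theorem operator_expansion (hl : l ≤ 𝓝 0) {ℒ : ℝ → E →L[ℝ] E} {t₀ : ℝ} {k : ℕ}
    {Λ : ℕ → E →L[ℝ] E}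
    (hΛ : (fun δ : ℝ => ℒ (t₀ + δ) - ∑ q : Fin k, δ ^ (q : ℕ) • Λ q) =O[𝓝 0] fun δ => δ ^ k)
    (c : ℝ) {V P : ℝ → E} (hV : (fun h => V h - P h) =O[l] fun h => h ^ k)
    (hP : P =O[l] fun _ => (1 : ℝ)) :
    (fun h => ℒ (t₀ + h * c) (V h) - ∑ q : Fin k, (h * c) ^ (q : ℕ) • Λ q (P h))
      =O[l] fun h => h ^ k := by
  have hlim : Tendsto (fun h : ℝ => h * c) l (𝓝 0) := by
    have : Tendsto (fun h : ℝ => h * c) (𝓝 0) (𝓝 (0 * c)) := tendsto_id.mul_const c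
    rw [zero_mul] at this
    exact this.mono_left hl
  have h1 : (fun h : ℝ => ℒ (t₀ + h * c) - ∑ q : Fin k, (h * c) ^ (q : ℕ) • Λ q)
      =O[l] fun h => h ^ k := by
    refine (hΛ.comp_tendsto hlim).trans ?_
    simp only [Function.comp_def, mul_pow]
    simpa only [mul_comm] using (isBigO_refl (fun h : ℝ => h ^ k) l).const_mul_left (c ^ k)
  have h2 : (fun h : ℝ => ∑ q : Fin k, (h * c) ^ (q : ℕ) • Λ q) =O[l] fun _ => (1 : ℝ) := by
    refine IsBigO.fun_sum fun q _ => ?_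
    have h3 := isBigO_pow_mul_smul hl (Nat.zero_le q) (c ^ (q : ℕ)) (Λ q)
    simpa [mul_pow] using h3
  have hV1 : V =O[l] fun _ => (1 : ℝ) := by
    have h3 := (hV.trans (isBigO_pow_of_le_nhds_zero hl (Nat.zero_le k))).add (by simpa using hP)
    simpa using h3
  have h4 : ∀ {A : ℝ → E →L[ℝ] E} {W : ℝ → E} {a b : ℝ → ℝ}, A =O[l] a → W =O[l] b →
      (fun h => A h (W h)) =O[l] fun h => a h * b h := by
    intro A W a b hA hW
    refine IsBigO.trans (IsBigO.of_bound 1 (Eventually.of_forall fun h => ?_))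
      (hA.norm_left.mul hW.norm_left)
    rw [one_mul, norm_mul, norm_norm, norm_norm]
    exact (A h).le_opNorm _
  -- With `S` the Taylor sum, the error splits as `(ℒ - S) V + S (V - P)`.
  have h5 := h4 h1 hV1
  have h6 := h4 h2 hV
  simp only [mul_one, one_mul] at h5 h6
  refine (h5.add h6).congr_left fun h => ?_
  simp only [sub_apply, sum_apply, smul_apply, map_sub]
  abel

/-- One stage (or the update) of the method maps expansions up to `O(h ^ k)` to expansions up to
`O(h ^ (k + 1))`. -/
theorem stage_expansion (hl : l ≤ 𝓝 0) {F : E → E} (hF : ContDiff ℝ ∞ F)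
    {y₀ : E} {k : ℕ} (hk : 1 ≤ k)
    {p : (m : ℕ) → ContinuousMultilinearMap ℝ (fun _ : Fin m => E) E}
    (hp : (fun δ : E => F (y₀ + δ) - ∑ m : Fin k, p m fun _ => δ) =O[𝓝 0] fun δ => ‖δ‖ ^ k)
    {ℒ : ℝ → E →L[ℝ] E} {t₀ : ℝ} {Λ : ℕ → E →L[ℝ] E}
    (hΛ : (fun δ : ℝ => ℒ (t₀ + δ) - ∑ q : Fin k, δ ^ (q : ℕ) • Λ q) =O[𝓝 0] fun δ => δ ^ k)
    {ι J : Type*} [Fintype ι] [Fintype J] {r : ι → ℕ} (hr : ∀ x, 1 ≤ r x)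
    (d : J → ι → ℝ) (u : ι → E) {X : J → ℝ → E}
    (hX : ∀ j, (fun h => X j h - (y₀ + ∑ x, (h ^ r x * d j x) • u x)) =O[l] fun h => h ^ k)
    (A Γ : J → ℝ) (c : ℝ) {Z : ℝ → E}
    (hZ : ∀ᶠ h in l, Z h = y₀ + h • ∑ j, A j • F (X j h)
      + h • ℒ (t₀ + h * c) (∑ j, Γ j • X j h)) :
    (fun h => Z h - (y₀ + ∑ x : NextIndex k ι,
      (h ^ nextOrder r x * nextCoeff A Γ c d x) • nextVector y₀ p Λ u x))
      =O[l] fun h => h ^ (k + 1) := by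
  have h1 : (fun h => ∑ j, A j • F (X j h) - ∑ j, A j • ∑ m : Fin k, ∑ f : Fin m → ι,
      (h ^ (∑ i, r (f i)) * ∏ i, d j (f i)) • p m (u ∘ f)) =O[l] fun h => h ^ k := by
    simp only [← Finset.sum_sub_distrib, ← smul_sub]
    exact IsBigO.fun_sum fun j _ => (hF.comp_expansion hl hk hp hr (d j) u (hX j)).const_smul_left _
  have h2 : (fun h => ∑ j, Γ j • X j h - ∑ j, Γ j • (y₀ + ∑ x, (h ^ r x * d j x) • u x))
      =O[l] fun h => h ^ k := by
    simp only [← Finset.sum_sub_distrib, ← smul_sub]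
    exact IsBigO.fun_sum fun j _ => (hX j).const_smul_left _
  have h3 : (fun h : ℝ => ∑ j, Γ j • (y₀ + ∑ x, (h ^ r x * d j x) • u x))
      =O[l] fun _ => (1 : ℝ) := by
    refine IsBigO.fun_sum fun j _ => IsBigO.const_smul_left ?_ _
    refine (isBigO_const_const y₀ one_ne_zero l).add (IsBigO.fun_sum fun x _ => ?_)
    simpa using isBigO_pow_mul_smul hl (Nat.zero_le (r x)) (d j x) (u x)
  -- The step size in front of both sums supplies the extra power.
  have h4 := (isBigO_refl (fun h : ℝ => h) l).smul (h1.add (operator_expansion hl hΛ c h2 h3))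
  refine IsBigO.congr' h4 ?_ (Eventually.of_forall fun h => by simp [pow_succ'])
  filter_upwards [hZ] with h hh
  rw [hh]
  simp only [NextIndex, Fintype.sum_sum_type, Fintype.sum_sigma, Fintype.sum_prod_type, nextOrder,
    nextCoeff, nextVector]
  have e1 : h • ∑ j, A j • ∑ m : Fin k, ∑ f : Fin m → ι,
      (h ^ (∑ i, r (f i)) * ∏ i, d j (f i)) • p m (u ∘ f) =
      ∑ m : Fin k, ∑ f : Fin m → ι,
        (h ^ (1 + ∑ i, r (f i)) * ∑ j, A j * ∏ i, d j (f i)) • p m (u ∘ f) := by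
    simp only [Finset.smul_sum, Finset.mul_sum, Finset.sum_smul]
    rw [Finset.sum_comm]
    refine Finset.sum_congr rfl fun m _ => ?_
    rw [Finset.sum_comm]
    refine Finset.sum_congr rfl fun f _ => Finset.sum_congr rfl fun j _ => ?_
    simp only [smul_smul]
    congr 1
    ring
  have e2 : h • ∑ q : Fin k, (h * c) ^ (q : ℕ) • Λ q (∑ j, Γ j • (y₀ + ∑ x, (h ^ r x * d j x) • u x))
      = ∑ q : Fin k, (h ^ ((q : ℕ) + 1) * ∑ j, c ^ (q : ℕ) * Γ j) • Λ q y₀ +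
        ∑ q : Fin k, ∑ x, (h ^ ((q : ℕ) + 1 + r x) * ∑ j, c ^ (q : ℕ) * Γ j * d j x) • Λ q (u x) := by
    rw [← Finset.sum_add_distrib, Finset.smul_sum]
    refine Finset.sum_congr rfl fun q _ => ?_
    simp only [map_sum, map_smul, map_add, smul_add, Finset.sum_add_distrib, Finset.smul_sum,
      Finset.mul_sum, Finset.sum_smul, smul_smul]
    congr 1
    · refine Finset.sum_congr rfl fun j _ => ?_
      congr 1
      ring
    · rw [Finset.sum_comm]
      refine Finset.sum_congr rfl fun x _ => Finset.sum_congr rfl fun j _ => ?_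
      congr 1
      ring
  rw [← e1, ← e2]
  simp only [smul_add, smul_sub]
  abel

end Expansion

/-- Taylor's formula for smooth curves. -/
theorem ContDiff.exists_taylor_real {G : Type} [NormedAddCommGroup G] [NormedSpace ℝ G]
    (t₀ : ℝ) (k : ℕ) {f : ℝ → G} (hf : ContDiff ℝ ∞ f) : ∃ q : ℕ → G,
      (fun δ : ℝ => f (t₀ + δ) - ∑ m : Fin k, δ ^ (m : ℕ) • q m) =O[𝓝 0] fun δ => δ ^ k := by
  obtain ⟨q, hq⟩ := ContDiff.exists_multilinear_taylor t₀ k hf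
  refine ⟨fun m => q m fun _ => 1, ?_⟩
  have h3 : ∀ (m : ℕ) (δ : ℝ), (q m fun _ => δ) = δ ^ m • (q m fun _ => 1) := fun m δ => by
    have := (q m).map_smul_univ (fun _ => δ) (fun _ => (1 : ℝ))
    simpa only [smul_eq_mul, mul_one, Finset.prod_const, Finset.card_univ, Fintype.card_fin]
  have hq' := hq.congr_left fun δ => by
    rw [Finset.sum_congr rfl fun (m : Fin k) _ => h3 m δ]
  refine hq'.trans (IsBigO.of_norm_left ?_)
  simpa using (isBigO_refl (fun δ : ℝ => δ ^ k) (𝓝 0)).norm_left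

/-! ### Tree coefficients of the solution and of the method -/

namespace LWTree

theorem one_le_order (τ : LWTree) : 1 ≤ τ.order := by
  cases τ <;> simp only [order] <;> omega

/-- The coefficient of a tree in the expansion of the exact solution. -/
noncomputable def exactCoeff : LWTree → ℝ
  | meagre m τ => (∏ i, (τ i).exactCoeff) / (meagre m τ).order
  | fatLeaf _ => 0
  | fat _ _ => 0

theorem exactCoeff_of_isButcher (τ : LWTree) (h : τ.IsButcher) :
    τ.exactCoeff = 1 / (τ.density : ℝ) := by
  induction τ with
  | meagre m τ ih =>
    simp only [IsButcher] at h
    rw [exactCoeff, density, Finset.prod_congr rfl fun i _ => ih i (h i)]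
    push_cast
    rw [Finset.prod_div_distrib, Finset.prod_const_one, div_div, mul_comm]
  | fatLeaf p => simp [IsButcher] at h
  | fat p τ ih => simp [IsButcher] at h

theorem exactCoeff_of_not_isButcher (τ : LWTree) (h : ¬ τ.IsButcher) : τ.exactCoeff = 0 := by
  induction τ with
  | meagre m τ ih =>
    simp only [IsButcher, not_forall] at h
    obtain ⟨i, hi⟩ := h
    rw [exactCoeff, Finset.prod_eq_zero (Finset.mem_univ i) (ih i hi), zero_div]
  | fatLeaf p => rw [exactCoeff]
  | fat p τ ih => rw [exactCoeff]

/-- The trees of the expansion indexed by `NextIndex`. -/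
def next {k : ℕ} {ι : Type*} (τ : ι → LWTree) : NextIndex k ι → LWTree
  | .inl ⟨m, f⟩ => meagre m fun i => τ (f i)
  | .inr (.inl q) => fatLeaf q
  | .inr (.inr (q, x)) => fat q (τ x)

theorem order_next {k : ℕ} {ι : Type*} (τ : ι → LWTree) (x : NextIndex k ι) :
    (next τ x).order = nextOrder (fun x => (τ x).order) x := by
  rcases x with ⟨m, f⟩ | q | ⟨q, x⟩ <;> simp only [next, nextOrder, order]

end LWTree

namespace LIRKW

variable {s : ℕ} (M : LIRKW s)

theorem phiBar_next {k : ℕ} {ι : Type*} (τ : ι → LWTree) (j : Fin s) (x : NextIndex k ι) :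
    M.PhiBar (LWTree.next τ x) j =
      nextCoeff (M.a j) (M.γ j) (M.γ j j) (fun j x => M.PhiBar (τ x) j) x := by
  rcases x with ⟨m, f⟩ | q | ⟨q, x⟩ <;> simp only [LWTree.next, nextCoeff, PhiBar]

/-- The update evaluates `L` at `t₀`, that is `c = 0`: the factor `0 ^ q` removes chains with square
vertices and is `1` for `q = 0`. This is why only trees in LW₃ give conditions. -/
theorem sum_phi_next {k : ℕ} {ι : Type*} (τ : ι → LWTree) (x : NextIndex k ι) :
    ∑ j, M.Phi (LWTree.next τ x) j =
      nextCoeff M.b M.g 0 (fun j x => M.PhiBar (τ x) j) x := by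
  rcases x with ⟨m, f⟩ | ⟨q, hq⟩ | ⟨⟨q, hq⟩, x⟩
  · simp only [LWTree.next, nextCoeff, Phi]
  · cases q <;> simp [LWTree.next, nextCoeff, Phi]
  · cases q <;> simp [LWTree.next, nextCoeff, Phi]

theorem phi_of_not_isLW3 (τ : LWTree) (h : ¬ τ.IsLW3) (j : Fin s) : M.Phi τ j = 0 := by
  rcases τ with ⟨m, τ⟩ | ⟨_ | p⟩ | ⟨_ | p, τ⟩ <;> simp_all [LWTree.IsLW3, Phi]

/-! ### Sufficiency: tree expansions of stages, update and solution -/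

section Expansion

variable {E : Type} [NormedAddCommGroup E] [NormedSpace ℝ E] {F : E → E} {ℒ : ℝ → E →L[ℝ] E}
  {t₀ : ℝ} {y : ℝ → E} {Y : ℝ → Fin s → E} {y₁ : ℝ → E}

/-- The stages deviate from the initial value by `O(h)`. -/
theorem stage_sub_isBigO (hF : Continuous F) (hL : Continuous ℒ) {y₀ : E}
    (hY : ∀ᶠ h in 𝓝[>] (0 : ℝ), ∀ i, Y h i = y₀ + h • ∑ j, M.a i j • F (Y h j)
      + h • ℒ (t₀ + h * M.γ i i) (∑ j, M.γ i j • Y h j)) (i : Fin s) :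
    (fun h => Y h i - y₀) =O[𝓝[>] (0 : ℝ)] fun h => h ^ 1 := by
  -- By triangularity only earlier stages occur, apart from the implicit term with `γᵢᵢ`.
  induction i using WellFoundedLT.induction with
  | ind i ih =>
  set l := 𝓝[>] (0 : ℝ)
  have hl : l ≤ 𝓝 0 := nhdsWithin_le_nhds
  have hid : Tendsto (fun h : ℝ => h) l (𝓝 0) := hl
  have hO1 : (fun h : ℝ => h) =O[l] fun _ => (1 : ℝ) := hid.isBigO_one ℝ
  have hlim : ∀ j < i, Tendsto (fun h => Y h j) l (𝓝 y₀) := fun j hj => by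
    have := (tendsto_zero_of_isBigO_pow hl le_rfl (ih j hj)).add_const y₀
    simpa using this
  have hA : (fun h => ∑ j, M.a i j • F (Y h j)) =O[l] fun _ => (1 : ℝ) := by
    refine IsBigO.fun_sum fun j _ => ?_
    by_cases hj : j < i
    · exact (((hF.tendsto y₀).comp (hlim j hj)).isBigO_one ℝ).const_smul_left _
    · simp only [M.a_strictlyLower i j (not_lt.1 hj), zero_smul]
      exact isBigO_zero _ l
  have hΓ : (fun h => ∑ j ∈ Finset.univ.erase i, M.γ i j • Y h j) =O[l] fun _ => (1 : ℝ) := by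
    refine IsBigO.fun_sum fun j hj => ?_
    by_cases hj' : j < i
    · exact ((hlim j hj').isBigO_one ℝ).const_smul_left _
    · have : i < j := lt_of_le_of_ne (not_lt.1 hj') (Finset.ne_of_mem_erase hj).symm
      simp only [M.γ_lower i j this, zero_smul]
      exact isBigO_zero _ l
  have hop : (fun h => ℒ (t₀ + h * M.γ i i)) =O[l] fun _ => (1 : ℝ) := by
    refine Tendsto.isBigO_one ℝ (c := ℒ (t₀ + 0 * M.γ i i)) ?_
    exact (hL.tendsto _).comp ((hid.mul_const _).const_add t₀)
  have happ : ∀ {W : ℝ → E}, W =O[l] (fun _ => (1 : ℝ)) →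
      (fun h => ℒ (t₀ + h * M.γ i i) (W h)) =O[l] fun _ => (1 : ℝ) := by
    intro W hW
    have h2 := hop.norm_left.mul hW.norm_left
    rw [one_mul] at h2
    refine IsBigO.trans (IsBigO.of_bound 1 (Eventually.of_forall fun h => ?_)) h2
    rw [one_mul, norm_mul, norm_norm, norm_norm]
    exact ContinuousLinearMap.le_opNorm _ _
  set R : ℝ → E := fun h => y₀ + h • ∑ j, M.a i j • F (Y h j)
      + h • ℒ (t₀ + h * M.γ i i) (∑ j ∈ Finset.univ.erase i, M.γ i j • Y h j) with hR
  have hRO : R =O[l] fun _ => (1 : ℝ) := by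
    refine ((isBigO_const_const y₀ one_ne_zero l).add ?_).add ?_
    · simpa using hO1.smul hA
    · simpa using hO1.smul (happ hΓ)
  have hsmall : ∀ᶠ h in l, ‖(h * M.γ i i) • ℒ (t₀ + h * M.γ i i)‖ < 1 / 2 := by
    have h1 : Tendsto (fun h => (h * M.γ i i) • ℒ (t₀ + h * M.γ i i)) l
        (𝓝 ((0 * M.γ i i) • ℒ (t₀ + 0 * M.γ i i))) :=
      (hid.mul_const _).smul ((hL.tendsto _).comp ((hid.mul_const _).const_add t₀))
    have h2 := h1.norm
    rw [zero_mul, zero_smul, norm_zero] at h2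
    exact h2.eventually_lt_const (by norm_num)
  have hsplit : ∀ h, ∑ j, M.γ i j • Y h j =
      M.γ i i • Y h i + ∑ j ∈ Finset.univ.erase i, M.γ i j • Y h j := fun h =>
    (Finset.add_sum_erase _ _ (Finset.mem_univ i)).symm
  have hYi : (fun h => Y h i) =O[l] fun _ => (1 : ℝ) := by
    -- The implicit term has norm at most `‖Y h i‖ / 2` by `hsmall`; absorbing it on the left gives
    -- the constant `2`.
    refine IsBigO.trans (IsBigO.of_bound 2 ?_) hRO
    filter_upwards [hY, hsmall] with h hh hs
    have h1 : Y h i = R h + ((h * M.γ i i) • ℒ (t₀ + h * M.γ i i)) (Y h i) := by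
      conv_lhs => rw [hh i, hsplit h]
      simp only [hR, map_add, map_smul, smul_add, smul_apply, mul_smul]
      abel
    have h2 : ‖Y h i‖ ≤ ‖R h‖ + 1 / 2 * ‖Y h i‖ := by
      conv_lhs => rw [h1]
      refine (norm_add_le _ _).trans (add_le_add le_rfl ?_)
      refine (ContinuousLinearMap.le_opNorm _ _).trans ?_
      gcongr
    linarith
  have hsum : (fun h => ∑ j, M.γ i j • Y h j) =O[l] fun _ => (1 : ℝ) := by
    simp only [hsplit]
    exact (hYi.const_smul_left _).add hΓ
  have hfin := (isBigO_refl (fun h : ℝ => h) l).smul (hA.add (happ hsum))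
  refine hfin.congr' ?_ (Eventually.of_forall fun h => by simp)
  filter_upwards [hY] with h hh
  rw [hh i, smul_add]
  abel

/-- Stages and exact solution have expansions up to `O(h ^ k)` with common trees and vectors. -/
def HasExpansion (t₀ : ℝ) (y : ℝ → E) (Y : ℝ → Fin s → E) (k : ℕ) : Prop :=
  ∃ (ι : Type) (_ : Fintype ι) (τ : ι → LWTree) (u : ι → E),
    (∀ j, (fun h => Y h j - (y t₀ + ∑ x, (h ^ (τ x).order * M.PhiBar (τ x) j) • u x))
      =O[𝓝[>] (0 : ℝ)] fun h => h ^ k) ∧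
    (fun h => y (t₀ + h) - (y t₀ + ∑ x, (h ^ (τ x).order * (τ x).exactCoeff) • u x))
      =O[𝓝 (0 : ℝ)] fun h => h ^ k

theorem HasExpansion.base (hF : Continuous F) (hL : Continuous ℒ)
    (hy : ∀ᶠ t in 𝓝 t₀, HasDerivAt y (F (y t)) t)
    (hY : ∀ᶠ h in 𝓝[>] (0 : ℝ), ∀ i, Y h i = y t₀ + h • ∑ j, M.a i j • F (Y h j)
      + h • ℒ (t₀ + h * M.γ i i) (∑ j, M.γ i j • Y h j)) :
    M.HasExpansion t₀ y Y 1 := by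
  -- Every tree has order at least one, so modulo `O(h)` no tree is needed.
  refine ⟨Empty, inferInstance, Empty.elim, Empty.elim, fun j => ?_, ?_⟩
  · simpa using M.stage_sub_isBigO hF hL hY j
  · have h1 : Tendsto (fun h : ℝ => t₀ + h) (𝓝 0) (𝓝 t₀) := by
      simpa using (tendsto_id (x := 𝓝 (0 : ℝ))).const_add t₀
    have h2 := hy.self_of_nhds.isBigO_sub.comp_tendsto h1
    simpa [Function.comp_def] using h2

/-- Termwise differentiation of the new sum gives the expansion of `F ∘ y`, because the division by
the order in `exactCoeff` cancels the exponent. Trees with fat root have coefficient `0` and are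
listed only to share indices and vectors with the method. -/
theorem exact_expansion (hF : ContDiff ℝ ∞ F) {k : ℕ} (hk : 1 ≤ k)
    {p : (m : ℕ) → ContinuousMultilinearMap ℝ (fun _ : Fin m => E) E}
    (hp : (fun δ : E => F (y t₀ + δ) - ∑ m : Fin k, p m fun _ => δ) =O[𝓝 0] fun δ => ‖δ‖ ^ k)
    (Λ : ℕ → E →L[ℝ] E)
    (hy : ∀ᶠ t in 𝓝 t₀, HasDerivAt y (F (y t)) t)
    {ι : Type} [Fintype ι] (τ : ι → LWTree) (u : ι → E)
    (h : (fun h => y (t₀ + h) - (y t₀ + ∑ x, (h ^ (τ x).order * (τ x).exactCoeff) • u x))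
      =O[𝓝 (0 : ℝ)] fun h => h ^ k) :
    (fun h => y (t₀ + h) - (y t₀ + ∑ x : NextIndex k ι,
      (h ^ (LWTree.next τ x).order * (LWTree.next τ x).exactCoeff) •
        nextVector (y t₀) p Λ u x)) =O[𝓝 (0 : ℝ)] fun h => h ^ (k + 1) := by
  refine IsBigO.integrate_pow ?_
    (hF.comp_expansion le_rfl hk hp (fun x => (τ x).one_le_order) _ u h) ?_
  · have h1 : Tendsto (fun h : ℝ => t₀ + h) (𝓝 0) (𝓝 t₀) := by
      simpa using (tendsto_id (x := 𝓝 (0 : ℝ))).const_add t₀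
    filter_upwards [h1.eventually hy] with h hh
    refine HasDerivAt.sub ?_ (HasDerivAt.const_add _ ?_)
    · exact hh.comp_const_add t₀ h
    · have h2 : HasDerivAt (fun h : ℝ => ∑ x : NextIndex k ι,
          (h ^ (LWTree.next τ x).order * (LWTree.next τ x).exactCoeff) •
            nextVector (y t₀) p Λ u x) _ h :=
        HasDerivAt.fun_sum fun x _ =>
          ((hasDerivAt_pow (LWTree.next τ x).order h).mul_const _).smul_const _
      convert h2 using 1
      simp only [NextIndex, Fintype.sum_sum_type, Fintype.sum_sigma, LWTree.next,
        LWTree.exactCoeff, mul_zero, zero_smul, Finset.sum_const_zero, add_zero, nextVector]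
      refine Finset.sum_congr rfl fun m _ => Finset.sum_congr rfl fun f _ => ?_
      congr 1
      have h3 : ((LWTree.meagre m fun i => τ (f i)).order : ℝ) ≠ 0 := by
        exact_mod_cast Nat.one_le_iff_ne_zero.1 (LWTree.one_le_order _)
      have h4 : (LWTree.meagre m fun i => τ (f i)).order - 1 = ∑ i, (τ (f i)).order := by
        rw [LWTree.order, Nat.add_sub_cancel_left]
      rw [h4]
      field_simp
  · have h5 : ∀ x : NextIndex k ι, (LWTree.next τ x).order ≠ 0 := fun x =>
      Nat.one_le_iff_ne_zero.1 (LWTree.one_le_order _)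
    simp [zero_pow (h5 _)]

/-- Implicitness is harmless here: the stages on the right-hand side carry a factor `h`, so knowing
them up to `O(h ^ k)` is enough. -/
theorem HasExpansion.succ (hF : ContDiff ℝ ∞ F) (hL : ContDiff ℝ ∞ ℒ)
    (hy : ∀ᶠ t in 𝓝 t₀, HasDerivAt y (F (y t)) t)
    (hY : ∀ᶠ h in 𝓝[>] (0 : ℝ), ∀ i, Y h i = y t₀ + h • ∑ j, M.a i j • F (Y h j)
      + h • ℒ (t₀ + h * M.γ i i) (∑ j, M.γ i j • Y h j))
    (hy₁ : ∀ᶠ h in 𝓝[>] (0 : ℝ), y₁ h = y t₀ + h • ∑ j, M.b j • F (Y h j)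
      + h • ℒ t₀ (∑ j, M.g j • Y h j)) {k : ℕ} (hk : 1 ≤ k) (h : M.HasExpansion t₀ y Y k) :
    M.HasExpansion t₀ y Y (k + 1) ∧ ∃ (ι : Type) (_ : Fintype ι) (τ : ι → LWTree) (u : ι → E),
      (fun h => y₁ h - (y t₀ + ∑ x, (h ^ (τ x).order * ∑ j, M.Phi (τ x) j) • u x))
        =O[𝓝[>] (0 : ℝ)] (fun h => h ^ (k + 1)) ∧
      (fun h => y (t₀ + h) - (y t₀ + ∑ x, (h ^ (τ x).order * (τ x).exactCoeff) • u x))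
        =O[𝓝 (0 : ℝ)] fun h => h ^ (k + 1) := by
  obtain ⟨ι, _, τ, u, h1, h2⟩ := h
  obtain ⟨p, hp⟩ := hF.exists_multilinear_taylor (y t₀) k
  obtain ⟨Λ, hΛ⟩ : ∃ Λ : ℕ → E →L[ℝ] E,
      (fun δ : ℝ => ℒ (t₀ + δ) - ∑ m : Fin k, δ ^ (m : ℕ) • Λ m) =O[𝓝 0] fun δ => δ ^ k := by
    obtain ⟨q, hq⟩ := ContDiff.exists_taylor_real t₀ k hL
    exact ⟨q, hq⟩
  have hl : 𝓝[>] (0 : ℝ) ≤ 𝓝 0 := nhdsWithin_le_nhds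
  have hex := exact_expansion hF hk hp Λ hy τ u h2
  refine ⟨⟨NextIndex k ι, inferInstance, LWTree.next τ, nextVector (y t₀) p Λ u, fun i => ?_, hex⟩,
    NextIndex k ι, inferInstance, LWTree.next τ, nextVector (y t₀) p Λ u, ?_, hex⟩
  · simp only [phiBar_next, LWTree.order_next]
    exact stage_expansion hl hF hk hp hΛ (fun x => (τ x).one_le_order) _ u h1 _ _ _
      (hY.mono fun h hh => hh i)
  · simp only [sum_phi_next, LWTree.order_next]
    refine stage_expansion hl hF hk hp hΛ (fun x => (τ x).one_le_order) _ u h1 _ _ _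
      (hy₁.mono fun h hh => ?_)
    rw [mul_zero, add_zero]
    exact hh

theorem error_isBigO (hF : ContDiff ℝ ∞ F) (hL : ContDiff ℝ ∞ ℒ)
    (hy : ∀ᶠ t in 𝓝 t₀, HasDerivAt y (F (y t)) t)
    (hY : ∀ᶠ h in 𝓝[>] (0 : ℝ), ∀ i, Y h i = y t₀ + h • ∑ j, M.a i j • F (Y h j)
      + h • ℒ (t₀ + h * M.γ i i) (∑ j, M.γ i j • Y h j))
    (hy₁ : ∀ᶠ h in 𝓝[>] (0 : ℝ), y₁ h = y t₀ + h • ∑ j, M.b j • F (Y h j)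
      + h • ℒ t₀ (∑ j, M.g j • Y h j)) {p : ℕ}
    (hcond : ∀ τ : LWTree, τ.order ≤ p → ∑ j, M.Phi τ j = τ.exactCoeff) :
    (fun h => y₁ h - y (t₀ + h)) =O[𝓝[>] (0 : ℝ)] fun h => h ^ (p + 1) := by
  have hexp : M.HasExpansion t₀ y Y (p + 1) := by
    induction p with
    | zero => exact HasExpansion.base M hF.continuous hL.continuous hy hY
    | succ p ih =>
      exact (HasExpansion.succ M hF hL hy hY hy₁ (by omega)
        (ih fun τ hτ => hcond τ (by omega))).1
  obtain ⟨-, ι, _, τ, u, h1, h2⟩ := HasExpansion.succ M hF hL hy hY hy₁ (by omega) hexp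
  have hl : 𝓝[>] (0 : ℝ) ≤ 𝓝 0 := nhdsWithin_le_nhds
  have h3 := (h1.sub (h2.mono hl)).trans
    (isBigO_pow_of_le_nhds_zero hl (Nat.le_succ (p + 1)))
  -- Trees of order at most `p` cancel by `hcond`; the power of `h` bounds all others.
  have h4 : (fun h : ℝ => ∑ x, (h ^ (τ x).order * (∑ j, M.Phi (τ x) j - (τ x).exactCoeff)) • u x)
      =O[𝓝[>] (0 : ℝ)] fun h => h ^ (p + 1) := by
    refine IsBigO.fun_sum fun x _ => ?_
    by_cases hx : (τ x).order ≤ p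
    · simpa [hcond _ hx] using isBigO_zero _ _
    · exact isBigO_pow_mul_smul hl (by omega) _ _
  refine (h3.add h4).congr_left fun h => ?_
  simp only [mul_sub, sub_smul, Finset.sum_sub_distrib]
  abel

end Expansion

/-- The bounded operator of a matrix. -/
noncomputable def matrixOperator {N : ℕ} (A : Matrix (Fin N) (Fin N) ℝ) :
    (Fin N → ℝ) →L[ℝ] (Fin N → ℝ) :=
  LinearMap.toContinuousLinearMap A.mulVecLin

theorem matrixOperator_apply {N : ℕ} (A : Matrix (Fin N) (Fin N) ℝ) (v : Fin N → ℝ) :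
    matrixOperator A v = A.mulVec v := rfl

theorem contDiff_matrixOperator {N : ℕ} {L : ℝ → Matrix (Fin N) (Fin N) ℝ}
    (hL : ∀ i j, ContDiff ℝ ∞ fun t => L t i j) :
    ContDiff ℝ ∞ fun t => matrixOperator (L t) := by
  rw [contDiff_clm_apply_iff]
  intro v
  simp only [matrixOperator_apply]
  rw [contDiff_pi]
  intro i
  simp only [Matrix.mulVec, dotProduct]
  exact ContDiff.sum fun j _ => (hL i j).mul contDiff_const

theorem hasOrderType3_of_conditions {p : ℕ}
    (hcond : ∀ τ : LWTree, τ.order ≤ p → ∑ j, M.Phi τ j = τ.exactCoeff) : M.HasOrderType3 p := by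
  intro N F L t₀ y Y y₁ hF hL hy hstep
  exact M.error_isBigO hF (contDiff_matrixOperator hL) hy (hstep.mono fun h hh => hh.stage)
    (hstep.mono fun h hh => hh.update) hcond

end LIRKW

/-! ### Necessity: a test system for each tree -/

theorem eq_zero_of_pow_mul_isBigO {c : ℝ} {r p : ℕ} (hr : r ≤ p)
    (h : (fun h : ℝ => h ^ r * c) =O[𝓝[>] (0 : ℝ)] fun h => h ^ (p + 1)) : c = 0 := by
  have h1 := h.mul (isBigO_refl (fun h : ℝ => (h ^ r)⁻¹) (𝓝[>] 0))
  have h2 : (fun _ : ℝ => c) =O[𝓝[>] (0 : ℝ)] fun h => h ^ (p + 1 - r) := by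
    refine h1.congr' ?_ ?_
    · filter_upwards [self_mem_nhdsWithin] with h hh
      have : h ≠ 0 := ne_of_gt hh
      field_simp
    · filter_upwards [self_mem_nhdsWithin] with h hh
      have : h ≠ 0 := ne_of_gt hh
      rw [pow_sub₀ h this (by omega)]
  exact tendsto_nhds_unique tendsto_const_nhds
    (tendsto_zero_of_isBigO_pow nhdsWithin_le_nhds (by omega) h2)

namespace LWTree

/-- Sets of trees that contain the subtrees of their members. -/
def SubtreeClosed (S : Set LWTree) : Prop :=
  (∀ m (σ : Fin m → LWTree), meagre m σ ∈ S → ∀ i, σ i ∈ S) ∧ ∀ q σ, fat q σ ∈ S → σ ∈ S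

/-- Finiteness makes the test system finite-dimensional. Chains of square vertices need no labels of
their own, as powers of `t` in the matrix encode them. -/
theorem exists_finite_subtreeClosed (τ : LWTree) :
    ∃ S : Set LWTree, S.Finite ∧ τ ∈ S ∧ SubtreeClosed S := by
  induction τ with
  | meagre m τ ih =>
    choose S hfin hmem hcl using ih
    refine ⟨insert (meagre m τ) (⋃ i, S i), (Set.finite_iUnion hfin).insert _,
      Set.mem_insert _ _, fun m' σ hσ i => Set.mem_insert_of_mem _ ?_,
      fun q σ hσ => Set.mem_insert_of_mem _ ?_⟩
    · rcases hσ with hσ | hσ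
      · obtain ⟨rfl, hσ⟩ := meagre.inj hσ
        obtain rfl := eq_of_heq hσ
        exact Set.mem_iUnion.2 ⟨i, hmem i⟩
      · obtain ⟨j, hj⟩ := Set.mem_iUnion.1 hσ
        exact Set.mem_iUnion.2 ⟨j, (hcl j).1 _ _ hj i⟩
    · rcases hσ with hσ | hσ
      · simp at hσ
      · obtain ⟨j, hj⟩ := Set.mem_iUnion.1 hσ
        exact Set.mem_iUnion.2 ⟨j, (hcl j).2 _ _ hj⟩
  | fatLeaf p =>
    exact ⟨{fatLeaf p}, Set.finite_singleton _, rfl, fun m σ h => by simp at h,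
      fun q σ h => by simp at h⟩
  | fat p τ ih =>
    obtain ⟨S, hfin, hmem, hcl⟩ := ih
    refine ⟨insert (fat p τ) S, hfin.insert _, Set.mem_insert _ _,
      fun m' σ hσ i => Set.mem_insert_of_mem _ ?_, fun q σ hσ => Set.mem_insert_of_mem _ ?_⟩
    · rcases hσ with hσ | hσ
      · simp at hσ
      · exact hcl.1 _ _ hσ i
    · rcases hσ with hσ | hσ
      · obtain ⟨-, rfl⟩ := fat.inj hσ
        exact hmem
      · exact hcl.2 _ _ hσ

/-- Coordinates `Fin N` labelled with the members of a subtree-closed set that contains `τ`, and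
with `none`, the label of a constant coordinate. -/
theorem exists_labelling (τ : LWTree) :
    ∃ (N : ℕ) (node : Fin N → Option LWTree) (idx : Option LWTree → Fin N),
      node (idx none) = none ∧ node (idx (some τ)) = some τ ∧
      (∀ n m (σ : Fin m → LWTree), node n = some (meagre m σ) →
        ∀ i, node (idx (some (σ i))) = some (σ i)) ∧
      ∀ n q σ, node n = some (fat q σ) → node (idx (some σ)) = some σ := by
  obtain ⟨S, hfin, hmem, hcl⟩ := exists_finite_subtreeClosed τ
  have hfin' : (insert none (some '' S)).Finite := (hfin.image some).insert none
  obtain ⟨N, node, -, hnode⟩ := hfin'.fin_param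
  have hsome : ∀ σ, some σ ∈ Set.range node ↔ σ ∈ S := fun σ => by simp [hnode]
  have hnone : none ∈ Set.range node := by simp [hnode]
  have : Nonempty (Fin N) := let ⟨n, _⟩ := hnone; ⟨n⟩
  have hinv : ∀ v ∈ Set.range node, node (Function.invFun node v) = v := fun v hv =>
    Function.invFun_eq hv
  exact ⟨N, node, Function.invFun node, hinv _ hnone, hinv _ ((hsome τ).2 hmem),
    fun n m σ h i => hinv _ ((hsome _).2 (hcl.1 m σ ((hsome _).1 ⟨n, h⟩) i)),
    fun n q σ h => hinv _ ((hsome _).2 (hcl.2 q σ ((hsome _).1 ⟨n, h⟩)))⟩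

/-- The value at step size `h` of the coordinate with a given label, for tree coefficients `κ`. -/
def coordValue (κ : LWTree → ℝ) (h : ℝ) : Option LWTree → ℝ
  | none => 1
  | some τ => h ^ τ.order * κ τ

/-- The component of the vector field at a given label: the product of the coordinates of the
children of a meagre root. -/
def fieldComponent {N : ℕ} (idx : Option LWTree → Fin N) (y : Fin N → ℝ) : Option LWTree → ℝ
  | some (meagre _ σ) => ∏ i, y (idx (some (σ i)))
  | _ => 0

/-- The row of the matrix function at a given label: the only nonzero entry of the row of
`[σ]_{θ_q}` is `t ^ q`, in the column of `σ` (or in the constant column, if nothing is attached). -/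
def matrixRow {N : ℕ} (idx : Option LWTree → Fin N) (t : ℝ) : Option LWTree → Fin N → ℝ
  | some (fatLeaf q) => Pi.single (idx none) (t ^ q)
  | some (fat q σ) => Pi.single (idx (some σ)) (t ^ q)
  | _ => 0

theorem contDiff_fieldComponent {N : ℕ} (idx : Option LWTree → Fin N) (v : Option LWTree) :
    ContDiff ℝ ∞ fun y : Fin N → ℝ => fieldComponent idx y v := by
  rcases v with _ | ⟨m, σ⟩ | q | ⟨q, σ⟩ <;> simp only [fieldComponent]
  · exact contDiff_const
  · exact contDiff_prod fun i _ => contDiff_apply ℝ ℝ _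
  · exact contDiff_const
  · exact contDiff_const

theorem contDiff_matrixRow {N : ℕ} (idx : Option LWTree → Fin N) (v : Option LWTree) (j : Fin N) :
    ContDiff ℝ ∞ fun t => matrixRow idx t v j := by
  rcases v with _ | ⟨m, σ⟩ | q | ⟨q, σ⟩ <;> simp only [matrixRow, Pi.single_apply, Pi.zero_apply]
  · exact contDiff_const
  · exact contDiff_const
  · split_ifs
    · exact contDiff_id.pow q
    · exact contDiff_const
  · split_ifs
    · exact contDiff_id.pow q
    · exact contDiff_const

/-- This is the exact solution of the test system. Labels with a fat or square root have zero field
component and stay at `0`, since the matrix does not enter the equation. -/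
theorem hasDerivAt_coordValue {N : ℕ} {node : Fin N → Option LWTree} {idx : Option LWTree → Fin N}
    (hm : ∀ n m (σ : Fin m → LWTree), node n = some (meagre m σ) →
        ∀ i, node (idx (some (σ i))) = some (σ i)) (t : ℝ) (n : Fin N) :
    HasDerivAt (fun t => coordValue exactCoeff t (node n))
      (fieldComponent idx (fun n => coordValue exactCoeff t (node n)) (node n)) t := by
  rcases hn : node n with _ | ⟨m, σ⟩ | q | ⟨q, σ⟩
  · exact hasDerivAt_const _ _
  · simp only [coordValue, fieldComponent, hm n m σ hn]
    refine ((hasDerivAt_pow (meagre m σ).order t).mul_const _).congr_deriv ?_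
    rw [Finset.prod_mul_distrib, Finset.prod_pow_eq_pow_sum, exactCoeff]
    have h3 : ((meagre m σ).order : ℝ) ≠ 0 := by
      exact_mod_cast Nat.one_le_iff_ne_zero.1 (one_le_order _)
    have h4 : (meagre m σ).order - 1 = ∑ i, (σ i).order := by
      rw [order, Nat.add_sub_cancel_left]
    rw [h4]
    field_simp
  · simpa [coordValue, fieldComponent, exactCoeff] using hasDerivAt_const t (0 : ℝ)
  · simpa [coordValue, fieldComponent, exactCoeff] using hasDerivAt_const t (0 : ℝ)

/-- The right-hand side of a stage or of the update for the system of a labelling. -/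
theorem coordValue_step {N : ℕ} {node : Fin N → Option LWTree} {idx : Option LWTree → Fin N}
    (hnone : node (idx none) = none)
    (hm : ∀ n m (σ : Fin m → LWTree), node n = some (meagre m σ) →
        ∀ i, node (idx (some (σ i))) = some (σ i))
    (hf : ∀ n q σ, node n = some (fat q σ) → node (idx (some σ)) = some σ)
    {s : ℕ} (A Γ : Fin s → ℝ) (c h : ℝ) (φ : LWTree → Fin s → ℝ) (κ : LWTree → ℝ) (n : Fin N)
    (h1 : ∀ m σ, node n = some (meagre m σ) → κ (meagre m σ) = ∑ j, A j * ∏ i, φ (σ i) j)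
    (h2 : ∀ q, node n = some (fatLeaf q) → κ (fatLeaf q) = ∑ j, c ^ q * Γ j)
    (h3 : ∀ q σ, node n = some (fat q σ) → κ (fat q σ) = ∑ j, c ^ q * Γ j * φ σ j) :
    coordValue κ h (node n) = coordValue exactCoeff 0 (node n) +
      h * ∑ j, A j * fieldComponent idx (fun n => coordValue (fun τ => φ τ j) h (node n)) (node n) +
      h * ∑ n', matrixRow idx (h * c) (node n) n' *
        ∑ j, Γ j * coordValue (fun τ => φ τ j) h (node n') := by
  rcases hn : node n with _ | ⟨m, σ⟩ | q | ⟨q, σ⟩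
  · simp [coordValue, fieldComponent, matrixRow]
  · simp only [coordValue, fieldComponent, matrixRow, hm n m σ hn, h1 m σ hn, order]
    simp only [zero_pow (Nat.one_le_iff_ne_zero.1 (Nat.le_add_right 1 _)), zero_mul, zero_add,
      Pi.zero_apply, Finset.sum_const_zero, mul_zero, add_zero, Finset.prod_mul_distrib,
      Finset.prod_pow_eq_pow_sum, Finset.mul_sum]
    refine Finset.sum_congr rfl fun j _ => ?_
    ring
  · simp only [coordValue, fieldComponent, matrixRow, Pi.single_apply, ite_mul, zero_mul,
      Finset.sum_ite_eq', Finset.mem_univ, if_true, hnone, h2 q hn, order, exactCoeff, mul_zero,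
      Finset.sum_const_zero, zero_add, mul_one]
    simp only [Finset.mul_sum]
    refine Finset.sum_congr rfl fun j _ => ?_
    ring
  · simp only [coordValue, fieldComponent, matrixRow, Pi.single_apply, ite_mul, zero_mul,
      Finset.sum_ite_eq', Finset.mem_univ, if_true, hf n q σ hn, h3 q σ hn, order, exactCoeff,
      mul_zero, Finset.sum_const_zero, zero_add]
    simp only [Finset.mul_sum]
    refine Finset.sum_congr rfl fun j _ => ?_
    ring

end LWTree

namespace LIRKW

variable {s : ℕ} (M : LIRKW s)

open LWTree in
/-- The order condition of a tree follows by applying the method to the system of a labelling. -/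
theorem HasOrderType3.sum_phi_eq {p : ℕ} (h : M.HasOrderType3 p) (τ : LWTree) (hτ : τ.IsLW3)
    (hp : τ.order ≤ p) : ∑ j, M.Phi τ j = τ.exactCoeff := by
  obtain ⟨N, node, idx, hnone, hroot, hm, hf⟩ := exists_labelling τ
  -- Initial time `0` makes the matrix entries of stage `i` equal to `(h γᵢᵢ) ^ q`, which supplies
  -- both the power of `h` and the factor `γᵢᵢ ^ q` of `q` square vertices. The `h * 0` in the
  -- update is the case `c = 0` of `coordValue_step`.
  have hmain := h N (fun y n => fieldComponent idx y (node n))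
    (fun t => Matrix.of fun n => matrixRow idx t (node n)) 0
    (fun t n => coordValue exactCoeff t (node n))
    (fun h j n => coordValue (fun σ => M.PhiBar σ j) h (node n))
    (fun h n => coordValue exactCoeff 0 (node n) +
      h * ∑ j, M.b j * fieldComponent idx
        (fun n => coordValue (fun τ => M.PhiBar τ j) h (node n)) (node n) +
      h * ∑ n', matrixRow idx (h * 0) (node n) n' *
        ∑ j, M.g j * coordValue (fun τ => M.PhiBar τ j) h (node n'))
    (contDiff_pi.2 fun n => contDiff_fieldComponent idx _)
    (fun i j => contDiff_matrixRow idx _ _)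
    (Eventually.of_forall fun t => hasDerivAt_pi.2 fun n => hasDerivAt_coordValue hm t n)
    (Eventually.of_forall fun h => ⟨fun i => funext fun n => ?_, funext fun n => ?_⟩)
  · have hc := (isBigO_pi.1 hmain) (idx (some τ))
    refine sub_eq_zero.1 (eq_zero_of_pow_mul_isBigO hp (hc.congr_left fun h => ?_))
    have hs := coordValue_step hnone hm hf M.b M.g 0 h M.PhiBar (fun σ => ∑ j, M.Phi σ j)
      (idx (some τ)) (fun m σ _ => by simp only [Phi])
      -- The label is `τ` itself, whose root is not square; so `q = 0` and `0 ^ q = 1`.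
      (fun q hq => by
        rw [hroot] at hq
        obtain rfl := Option.some.inj hq
        obtain rfl : q = 0 := hτ
        simp [Phi])
      (fun q σ hq => by
        rw [hroot] at hq
        obtain rfl := Option.some.inj hq
        obtain rfl : q = 0 := hτ
        simp [Phi])
    simp only [Pi.sub_apply]
    rw [← hs, hroot, zero_add]
    simp only [coordValue, mul_sub]
  · have hs := coordValue_step hnone hm hf (M.a i) (M.γ i) (M.γ i i) h M.PhiBar
      (fun σ => M.PhiBar σ i) n (fun m σ _ => by simp only [PhiBar])
      (fun q _ => by simp only [PhiBar]) (fun q σ _ => by simp only [PhiBar])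
    simpa [Matrix.mulVec, dotProduct, Finset.sum_apply] using hs
  · simp [Matrix.mulVec, dotProduct, Finset.sum_apply]

end LIRKW

theorem theorem3 {s : ℕ} (M : LIRKW s) (p : ℕ) :
    M.HasOrderType3 p ↔
      (∀ τ : LWTree, τ.IsButcher → τ.order ≤ p → ∑ j, M.Phi τ j = 1 / (τ.density : ℝ)) ∧
      (∀ τ : LWTree, τ.IsLW3 → ¬ τ.IsButcher → τ.order ≤ p → ∑ j, M.Phi τ j = 0) := by
  have hLW3 : ∀ τ : LWTree, τ.IsButcher → τ.IsLW3 := fun τ hτ => by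
    cases τ <;> simp_all [LWTree.IsButcher, LWTree.IsLW3]
  constructor
  · intro h
    refine ⟨fun τ hτ hp => ?_, fun τ hτ hB hp => ?_⟩
    · rw [← τ.exactCoeff_of_isButcher hτ]
      exact LIRKW.HasOrderType3.sum_phi_eq M h τ (hLW3 τ hτ) hp
    · rw [← τ.exactCoeff_of_not_isButcher hB]
      exact LIRKW.HasOrderType3.sum_phi_eq M h τ hτ hp
  · rintro ⟨h1, h2⟩
    refine M.hasOrderType3_of_conditions fun τ hp => ?_
    by_cases hB : τ.IsButcher
    · rw [h1 τ hB hp, τ.exactCoeff_of_isButcher hB]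
    · rw [τ.exactCoeff_of_not_isButcher hB]
      -- Trees with square root occur in the expansion, but their condition reads `0 = 0`.
      by_cases hτ : τ.IsLW3
      · exact h2 τ hτ hB hp
      · exact Finset.sum_eq_zero fun j _ => M.phi_of_not_isLW3 τ hτ j
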